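/- A weighted digraph $(D,w)$ consists of a finite digraph $D=(V,A)$, in which parallel and opposite arcs are allowed but loops are not, and a weight vector $w\in\mathbb{Z}_{\ge 0}^A$; for $F\subseteq A$ write $w(F)=\sum_{a\in F}w_a$. For $U\subseteq V$ let $\delta^+(U)$ and $\delta^-(U)$ be the sets of arcs leaving and entering $U$, and write $\delta^{\pm}(v)=\delta^{\pm}(\{v\})$. A dicut is an arc set $\delta^+(U)$ for a nonempty proper subset $U\subsetneq V$ with $\delta^-(U)=\emptyset$. A dijoin is a set of arcs that intersects every dicut. A $w$-weighted packing of dijoins of size $k$ is a collection $J_1,\dots,J_k$ of (not necessarily distinct) dijoins such that every arc $a$ belongs to at most $w_a$ of them; it is equitable if $|J_i\cap C|-|J_j\cap C|\in\{-1,0,1\}$ for all $i,j\in\{1,\dots,k\}$ and every inclusionwise minimal dicut $C$. Let $(D=(V,A),w)$ be a weighted digraph in which no dicut has weight zero, and let $g:=\gcd\{w(\delta^+(v))-w(\delta^-(v)) : v\in V\}$, where $g=0$ if all these values are $0$. Then there exists an equitable $w$-weighted packing of dijoins of $D$ of size $g$. -/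

import Mathlib

open Finset

/-- A digraph with vertex set `V` and arc set `A`: parallel and opposite arcs are allowed,
loops are not. -/
structure ArcDigraph (V A : Type*) where
  tail : A → V
  head : A → V
  loopless : ∀ a, tail a ≠ head a

namespace ArcDigraph

variable {V A : Type*} [Fintype V] [Fintype A] [DecidableEq V] [DecidableEq A]

/-- `δ⁺(U)`: the arcs leaving `U`. -/
def outCut (D : ArcDigraph V A) (U : Finset V) : Finset A :=
  {a | D.tail a ∈ U ∧ D.head a ∉ U}

/-- `δ⁻(U)`: the arcs entering `U`. -/
def inCut (D : ArcDigraph V A) (U : Finset V) : Finset A :=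
  {a | D.tail a ∉ U ∧ D.head a ∈ U}

/-- A dicut is an arc set `δ⁺(U)` for a nonempty proper vertex subset `U` with `δ⁻(U) = ∅`. -/
def IsDicut (D : ArcDigraph V A) (C : Finset A) : Prop :=
  ∃ U : Finset V, U.Nonempty ∧ U ≠ univ ∧ D.inCut U = ∅ ∧ C = D.outCut U

/-- A dijoin is an arc set that meets every dicut. -/
def IsDijoin (D : ArcDigraph V A) (J : Finset A) : Prop :=
  ∀ C : Finset A, D.IsDicut C → (J ∩ C).Nonempty

/-- A `w`-weighted packing of `k` (not necessarily distinct) dijoins: every arc `a` lies in at most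
`w a` of them. -/
def IsPacking (D : ArcDigraph V A) (w : A → ℕ) {k : ℕ} (J : Fin k → Finset A) : Prop :=
  (∀ i, D.IsDijoin (J i)) ∧ ∀ a : A, #{i | a ∈ J i} ≤ w a

/-- `J` is equitable: on every inclusionwise minimal dicut `C`, any two members of `J` differ by at
most one in the number of arcs of `C` that they contain. -/
def IsEquitable (D : ArcDigraph V A) {k : ℕ} (J : Fin k → Finset A) : Prop :=
  ∀ C : Finset A, Minimal D.IsDicut C →
    ∀ i j, (#(J i ∩ C) : ℤ) - (#(J j ∩ C) : ℤ) ∈ ({-1, 0, 1} : Set ℤ)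

/-- `w(F)`: the total weight of an arc set `F`. -/
def weight (w : A → ℕ) (F : Finset A) : ℕ := ∑ a ∈ F, w a

/-- `w(δ⁺(v)) - w(δ⁻(v))`. -/
def excess (D : ArcDigraph V A) (w : A → ℕ) (v : V) : ℤ :=
  (weight w (D.outCut {v}) : ℤ) - (weight w (D.inCut {v}) : ℤ)

/-- The (nonnegative) gcd of the integers `w(δ⁺(v)) - w(δ⁻(v))` over all vertices `v`; it is `0`
when they all vanish. -/
def excessGCD (D : ArcDigraph V A) (w : A → ℕ) : ℕ :=
  (univ.gcd (D.excess w)).natAbs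

end ArcDigraph

namespace ArcDigraph

variable {V A : Type*} [Fintype V] [Fintype A] [DecidableEq V] [DecidableEq A]

/-! Reduce `w` modulo `g`: the residues `r` still have all excesses divisible by `g`, say `g • b`.
By `exists_decomposition`, `r` splits into `g` arc sets of the same excess `b`. The size of such a
set on a dicut is the sum of `b` over the shore, so all of them meet each dicut equally often, and
if one meets it, all do. Dicuts on which `r` vanishes are met by the arcs of positive weight
divisible by `g`, which can be added to every set. -/

theorem excess_eq_sum (D : ArcDigraph V A) (w : A → ℕ) (v : V) :
    D.excess w v =
      ∑ a, (w a : ℤ) * ((if D.tail a = v then 1 else 0) - (if D.head a = v then 1 else 0)) := by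
  have hout : D.outCut {v} = univ.filter (fun a => D.tail a = v) := by
    ext a
    have := D.loopless a
    simp only [outCut, mem_filter, mem_univ, true_and, mem_singleton]
    grind
  have hin : D.inCut {v} = univ.filter (fun a => D.head a = v) := by
    ext a
    have := D.loopless a
    simp only [inCut, mem_filter, mem_univ, true_and, mem_singleton]
    grind
  simp only [excess, weight, hout, hin, mul_sub, mul_ite, mul_one, mul_zero, sum_sub_distrib,
    Nat.cast_sum, sum_filter, Nat.cast_ite, Nat.cast_zero]

/-- The weight of a dicut is the total excess of its shore. -/
theorem sum_excess_of_inCut_eq_empty (D : ArcDigraph V A) (w : A → ℕ) {U : Finset V}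
    (hU : D.inCut U = ∅) : ∑ v ∈ U, D.excess w v = weight w (D.outCut U) := by
  simp only [excess_eq_sum, weight, outCut, sum_filter, Nat.cast_sum]
  rw [sum_comm]
  refine sum_congr rfl fun a _ => ?_
  have ha : a ∉ D.inCut U := by simp [hU]
  simp only [inCut, mem_filter, mem_univ, true_and, not_and] at ha
  rw [← mul_sum, sum_sub_distrib, sum_ite_eq, sum_ite_eq]
  by_cases h1 : D.tail a ∈ U <;> by_cases h2 : D.head a ∈ U <;> simp_all

/-- If `r ≤ k` has excess `k • b`, then some arc set of excess `b` contains every arc with `r a = k`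
and no arc with `r a = 0`. Each arc is matched to a slot at one of its ends by Hall's theorem. -/
theorem exists_finset_excess_eq (D : ArcDigraph V A) {k : ℕ} (hk : 0 < k) (r : A → ℕ)
    (hr : ∀ a, r a ≤ k) (b : V → ℤ) (hb : ∀ v, D.excess r v = k * b v) :
    ∃ y : Finset A, (∀ v, D.excess (fun a => if a ∈ y then 1 else 0) v = b v) ∧
      (∀ a ∈ y, 0 < r a) ∧ ∀ a ∉ y, r a < k := by
  -- Each arc distributes `k` units over its ends, `r a` to the tail and the rest to the head; `v`
  -- then receives `k` times `b v` plus its indegree, hence `n v` slots.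
  set c : A → V → ℕ := fun a v =>
    (if D.tail a = v then r a else 0) + (if D.head a = v then k - r a else 0) with hc
  have hcsum : ∀ a, ∑ v, c a v = k := fun a => by
    have := hr a
    simp only [hc, sum_add_distrib, sum_ite_eq, mem_univ, if_true]
    omega
  have hn0 : ∀ v, ((∑ a, c a v : ℕ) : ℤ) =
      k * (b v + ∑ a, if D.head a = v then 1 else 0) := fun v => by
    rw [mul_add, ← hb v, excess_eq_sum, mul_sum, ← sum_add_distrib, Nat.cast_sum]
    refine sum_congr rfl fun a _ => ?_
    simp only [hc]
    split_ifs <;> push_cast [hr a] <;> ring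
  have hdvd : ∀ v, k ∣ ∑ a, c a v := fun v => by
    rw [← Int.natCast_dvd_natCast, hn0 v]
    exact dvd_mul_right _ _
  choose n hn using hdvd
  have hnb : ∀ v, (n v : ℤ) = b v + ∑ a, if D.head a = v then 1 else 0 := fun v => by
    have h := hn0 v
    rw [hn v] at h
    push_cast at h
    exact mul_left_cancel₀ (by exact_mod_cast hk.ne') h
  let nb : A → Finset V := fun a => univ.filter fun v => c a v ≠ 0
  let t : A → Finset (Σ v, Fin (n v)) := fun a => (nb a).sigma fun _ => univ
  have hall : ∀ S : Finset A, #S ≤ #(S.biUnion t) := by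
    intro S
    have ht : S.biUnion t = (S.biUnion nb).sigma fun _ => univ := by
      ext ⟨v, i⟩
      simp [t]
    rw [ht, card_sigma]
    simp only [card_univ, Fintype.card_fin]
    refine Nat.le_of_mul_le_mul_left ?_ hk
    calc k * #S = ∑ a ∈ S, ∑ v, c a v := by simp [hcsum, mul_comm]
      _ = ∑ a ∈ S, ∑ v ∈ S.biUnion nb, c a v := by
        refine sum_congr rfl fun a ha => (sum_subset (subset_univ _) fun v _ hv => ?_).symm
        by_contra h
        exact hv (mem_biUnion.2 ⟨a, ha, by simpa [nb] using h⟩)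
      _ = ∑ v ∈ S.biUnion nb, ∑ a ∈ S, c a v := sum_comm
      _ ≤ ∑ v ∈ S.biUnion nb, k * n v := by
        refine sum_le_sum fun v _ => ?_
        rw [← hn v]
        exact sum_le_sum_of_subset (subset_univ S)
      _ = k * ∑ v ∈ S.biUnion nb, n v := (mul_sum _ _ _).symm
  obtain ⟨f, hf, hft⟩ := (all_card_le_biUnion_card_iff_exists_injective t).1 hall
  -- Arcs and slots are equinumerous, so the matching fills every slot.
  have hcard : Fintype.card A = Fintype.card (Σ v, Fin (n v)) := by
    simp only [Fintype.card_sigma, Fintype.card_fin]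
    refine Nat.eq_of_mul_eq_mul_left hk ?_
    rw [mul_sum, ← sum_congr rfl fun v _ => hn v, sum_comm]
    simp [hcsum, mul_comm]
  have hbij : Function.Bijective f := (Fintype.bijective_iff_injective_and_card f).2 ⟨hf, hcard⟩
  have hfc : ∀ a, c a (f a).1 ≠ 0 := fun a => by
    have := hft a
    simpa [t, nb] using this
  have hfib : ∀ v, #{a | (f a).1 = v} = n v := fun v => by
    have h : (univ.filter fun a => (f a).1 = v).map ⟨f, hf⟩ =
        (univ : Finset (Fin (n v))).map (Function.Embedding.sigmaMk v) := by
      ext ⟨u, i⟩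
      simp only [mem_map, mem_filter, mem_univ, true_and, Function.Embedding.coeFn_mk,
        Function.Embedding.sigmaMk_apply]
      constructor
      · rintro ⟨a, rfl, h⟩
        have hu : (f a).1 = u := by rw [h]
        subst hu
        exact ⟨i, rfl⟩
      · rintro ⟨j, h⟩
        obtain ⟨a, ha⟩ := hbij.2 ⟨u, i⟩
        exact ⟨a, by rw [ha]; exact (congrArg Sigma.fst h).symm, ha⟩
    rw [← card_map ⟨f, hf⟩, h, card_map, card_univ, Fintype.card_fin]
  -- Take the arcs matched to their tail: the excess at `v` is `n v` minus the indegree. An end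
  -- receiving no units is never chosen, which settles `r a = 0` and `r a = k`.
  refine ⟨univ.filter fun a => (f a).1 = D.tail a, fun v => ?_, fun a ha => ?_, fun a ha => ?_⟩
  · have h1 := hnb v
    rw [← hfib v, card_filter, Nat.cast_sum] at h1
    rw [excess_eq_sum, ← sub_eq_of_eq_add h1, ← sum_sub_distrib]
    refine sum_congr rfl fun a _ => ?_
    have hl := D.loopless a
    have hca := hfc a
    simp only [hc] at hca
    simp only [mem_filter, mem_univ, true_and]
    have hends : (f a).1 = D.tail a ∨ (f a).1 = D.head a := by grind
    rcases hends with h | h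
    · simp [h]
    · simp [h, hl.symm]
  · have hl := D.loopless a
    have hca := hfc a
    simp only [mem_filter, mem_univ, true_and] at ha
    simp only [hc, ha, if_true, if_neg hl.symm] at hca
    omega
  · have hca := hfc a
    simp only [mem_filter, mem_univ, true_and] at ha
    simp only [hc, if_neg (Ne.symm ha)] at hca
    split_ifs at hca <;> omega

/-- Integer decomposition: if `r ≤ k` has excess `k • b`, then `r` is the sum of `k` arc sets, each
of excess `b`. -/
theorem exists_decomposition (D : ArcDigraph V A) (b : V → ℤ) (k : ℕ) (r : A → ℕ)
    (hr : ∀ a, r a ≤ k) (hb : ∀ v, D.excess r v = k * b v) :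
    ∃ y : Fin k → Finset A, (∀ i v, D.excess (fun a => if a ∈ y i then 1 else 0) v = b v) ∧
      ∀ a, #{i | a ∈ y i} = r a := by
  induction k generalizing r with
  | zero => exact ⟨fun _ => ∅, fun i => i.elim0, fun a => by simpa using (Nat.le_zero.1 (hr a)).symm⟩
  | succ k ih =>
    -- Since `y` contains every arc with `r a = k + 1`, removing it leaves values at most `k`.
    obtain ⟨y, hy, hpos, hlt⟩ := D.exists_finset_excess_eq k.succ_pos r hr b hb
    have hle : ∀ a, (if a ∈ y then 1 else 0) ≤ r a := fun a => by
      split_ifs with h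
      · exact hpos a h
      · exact Nat.zero_le _
    obtain ⟨z, hz, hzr⟩ := ih (fun a => r a - if a ∈ y then 1 else 0)
      (fun a => by
        have := hr a
        have := hlt a
        split_ifs with h
        · omega
        · have := this h
          omega)
      (fun v => by
        have h1 := hb v
        have h2 := hy v
        rw [excess_eq_sum] at h1 h2 ⊢
        have h3 : (k : ℤ) * b v = ((k + 1 : ℕ) : ℤ) * b v - b v := by push_cast; ring
        rw [h3, ← h1, ← h2, ← sum_sub_distrib]
        refine sum_congr rfl fun a _ => ?_
        rw [Nat.cast_sub (hle a)]
        ring)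
    refine ⟨Fin.cons y z, fun i => Fin.cases hy hz i, fun a => ?_⟩
    have h := hzr a
    have h' := hle a
    rw [card_filter] at h ⊢
    rw [Fin.sum_univ_succ]
    simp only [Fin.cons_zero, Fin.cons_succ]
    rw [h]
    omega

end ArcDigraph

theorem ArcDigraph.excessGCD_dvd_excess {V A : Type*} [Fintype V] [Fintype A] [DecidableEq V]
    (D : ArcDigraph V A) (w : A → ℕ) (v : V) :
    (D.excessGCD w : ℤ) ∣ D.excess w v :=
  Int.natAbs_dvd.2 (gcd_dvd (mem_univ v))

theorem mainTheorem8 {V A : Type*} [Fintype V] [Fintype A] [DecidableEq V] [DecidableEq A]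
    (D : ArcDigraph V A) (w : A → ℕ)
    (hw : ∀ C : Finset A, D.IsDicut C → ArcDigraph.weight w C ≠ 0) :
    ∃ J : Fin (D.excessGCD w) → Finset A, D.IsPacking w J ∧ D.IsEquitable J := by
  set g := D.excessGCD w with hg
  rcases Nat.eq_zero_or_pos g with h0 | hpos
  · have hno : Fin g → False := fun i => by
      have := i.2
      omega
    exact ⟨fun _ => ∅, ⟨fun i => (hno i).elim, fun a => by
      rw [filter_true_of_mem fun i _ => (hno i).elim, card_univ, Fintype.card_fin, h0]
      exact Nat.zero_le _⟩, fun _ _ i => (hno i).elim⟩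
  have hdvd : ∀ v, (g : ℤ) ∣ D.excess (fun a => w a % g) v := fun v => by
    have h : D.excess (fun a => w a % g) v =
        D.excess w v - g * D.excess (fun a => w a / g) v := by
      simp only [ArcDigraph.excess_eq_sum]
      rw [mul_sum, ← sum_sub_distrib]
      refine sum_congr rfl fun a _ => ?_
      push_cast
      rw [Int.emod_def]
      ring
    rw [h]
    exact dvd_sub (D.excessGCD_dvd_excess w v) (dvd_mul_right _ _)
  choose b hb using hdvd
  obtain ⟨y, hy, hyr⟩ :=
    D.exists_decomposition b g (fun a => w a % g) (fun a => (Nat.mod_lt _ hpos).le) hb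
  -- These arcs have residue zero and weight at least `g`, so they fit into all `g` sets.
  set B : Finset A := {a | 0 < w a ∧ g ∣ w a} with hB
  have hdisj : ∀ i, Disjoint (y i) B := fun i => by
    refine disjoint_left.2 fun a hai haB => ?_
    have h1 : 0 < #{i | a ∈ y i} := card_pos.2 ⟨i, by simpa using hai⟩
    simp only [hB, mem_filter, mem_univ, true_and] at haB
    rw [hyr a, Nat.mod_eq_zero_of_dvd haB.2] at h1
    exact h1.false
  have hsame : ∀ C, D.IsDicut C → ∀ i j, #(y i ∩ C) = #(y j ∩ C) := by
    rintro C ⟨U, -, -, hU, rfl⟩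
    have h : ∀ i, (#(y i ∩ D.outCut U) : ℤ) = ∑ v ∈ U, b v := fun i => by
      rw [← sum_congr rfl fun v _ => hy i v, D.sum_excess_of_inCut_eq_empty _ hU,
        ArcDigraph.weight, ← card_filter, filter_mem_eq_inter, inter_comm]
    intro i j
    exact_mod_cast (h i).trans (h j).symm
  refine ⟨fun i => y i ∪ B, ⟨fun i C hC => ?_, fun a => ?_⟩, fun C hC i j => ?_⟩
  · obtain ⟨a, haC, ha⟩ := exists_ne_zero_of_sum_ne_zero (hw C hC)
    by_cases hga : g ∣ w a
    · exact ⟨a, by simp [hB, haC, hga, Nat.pos_of_ne_zero ha]⟩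
    · have h1 : 0 < #{i | a ∈ y i} := by
        rw [hyr a]
        exact Nat.pos_of_ne_zero fun h => hga (Nat.dvd_of_mod_eq_zero h)
      obtain ⟨j, hj⟩ := card_pos.1 h1
      have h2 : 0 < #(y j ∩ C) := card_pos.2 ⟨a, by simpa [haC] using hj⟩
      rw [hsame C hC j i] at h2
      exact (card_pos.1 h2).mono (inter_subset_inter_right subset_union_left)
  · by_cases ha : a ∈ B
    · simp only [hB, mem_filter, mem_univ, true_and] at ha
      exact (card_le_univ _).trans ((Fintype.card_fin g).trans_le (Nat.le_of_dvd ha.1 ha.2))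
    · simp only [mem_union, ha, or_false]
      rw [hyr a]
      exact Nat.mod_le _ _
  · have h : #((y i ∪ B) ∩ C) = #((y j ∪ B) ∩ C) := by
      have hc : ∀ i, #((y i ∪ B) ∩ C) = #(y i ∩ C) + #(B ∩ C) := fun i => by
        rw [union_inter_distrib_right, card_union_of_disjoint]
        exact (hdisj i).mono inter_subset_left inter_subset_left
      rw [hc i, hc j, hsame C hC.prop i j]
    simp [h]
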